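/- Let $a$ and $j$ be integers with $a\ge 2$ and $0\le j\le a-1$. Put $E(q)=\prod_{n=1}^\infty(1-q^n)$, $\omega_a=\exp(2\pi i/a)$, $\vec 1_a=(1,1,\dots,1)\in\mathbb Z^a$ and $\vec b_a=(0,1,2,\dots,a-1)$. Then for all complex $z\neq 0$ and $|q|<1$ the series \[ B_{j,a}(z;q):=\sum_{\substack{\vec n=(n_0,\dots,n_{a-1})\in\mathbb Z^a\\ \vec n\cdot\vec 1_a=0}} z^{n_j}\,\omega_a^{\vec b_a\cdot\vec n}\,q^{\frac12\vec n\cdot\vec n} \] converges absolutely, and \[ B_{j,a}(z;q)=E(q)^{a-2}\,E(q^a)\prod_{n=1}^\infty\frac{(1-zq^{n-1})(1-z^{-1}q^{n})}{(1-zq^{a(n-1)})(1-z^{-1}q^{an})}, \] where at those $z$ at which a denominator on the right vanishes (all of which are removable singularities of the right side in $z$) the right side is understood as its limit. -/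

import Mathlib

open Filter Topology Matrix

noncomputable section

/-- `E(q) = ∏_{n ≥ 1} (1 - q ^ n)`. -/
def eulerE (q : ℂ) : ℂ := ∏' n : ℕ, (1 - q ^ (n + 1))

/-- The product defining `E(q)` converges for `|q| < 1`. -/
theorem multipliable_eulerE {q : ℂ} (hq : ‖q‖ < 1) :
    Multipliable fun n : ℕ => 1 - q ^ (n + 1) := by
  have h : Summable fun n : ℕ => ‖-q ^ (n + 1)‖ := by
    simp only [norm_neg, norm_pow]
    exact (summable_nat_add_iff 1).2 (summable_geometric_of_lt_one (norm_nonneg q) hq)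
  simpa [sub_eq_add_neg] using multipliable_one_add_of_summable h

/-- The lattice of integer vectors `(n_0, …, n_{a-1})` whose coordinates sum to zero. -/
abbrev ZeroSumVec (a : ℕ) : Type := {n : Fin a → ℤ // n ⬝ᵥ 1 = 0}

/-- On the zero-sum lattice `n ⬝ᵥ n` is even, so the integer division by two in the exponent
of `q` below is exact. -/
theorem ZeroSumVec.two_mul_half {a : ℕ} (n : ZeroSumVec a) :
    2 * ((n.1 ⬝ᵥ n.1) / 2) = n.1 ⬝ᵥ n.1 := by
  apply Int.mul_ediv_cancel'
  have h : (2 : ℤ) ∣ n.1 ⬝ᵥ n.1 - n.1 ⬝ᵥ 1 := by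
    simp only [dotProduct, Pi.one_apply, mul_one, ← Finset.sum_sub_distrib]
    refine Finset.dvd_sum fun i _ => ?_
    have := Int.even_mul_pred_self (n.1 i)
    rw [mul_sub, mul_one] at this
    exact this.two_dvd
  simpa [n.2] using h

/-- The vector `(0, 1, …, a - 1)`. -/
def bVec (a : ℕ) : Fin a → ℤ := fun i => (i : ℤ)

/-- The root of unity `exp (2 π i / a)`. -/
def rootω (a : ℕ) : ℂ := Complex.exp (2 * Real.pi * Complex.I / a)

/-- The term of the series `B_{j,a}(z;q)` at the lattice vector `n`. -/
def termB {a : ℕ} (j : Fin a) (z q : ℂ) (n : ZeroSumVec a) : ℂ :=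
  z ^ (n.1 j) * rootω a ^ (bVec a ⬝ᵥ n.1) * q ^ ((n.1 ⬝ᵥ n.1) / 2)

/-- The series `B_{j,a}(z;q)`. -/
def seriesB {a : ℕ} (j : Fin a) (z q : ℂ) : ℂ := ∑' n : ZeroSumVec a, termB j z q n

/-- The factor of index `n + 1` of the product side. -/
def quotFactor (a : ℕ) (z q : ℂ) (n : ℕ) : ℂ :=
  ((1 - z * q ^ n) * (1 - z⁻¹ * q ^ (n + 1))) /
    ((1 - z * q ^ (a * n)) * (1 - z⁻¹ * q ^ (a * (n + 1))))

/-- The product side. -/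
def productSide (a : ℕ) (z q : ℂ) : ℂ :=
  eulerE q ^ (a - 2) * eulerE (q ^ a) * ∏' n : ℕ, quotFactor a z q n

end

/-! Write `θ(q; z)` for `∑ (-1)^m q^(m(m-1)/2) z^m`. For `q ≠ 0` the heart of the matter is that
`B(z) θ(q^a; z) = c θ(q; z)` with `c` independent of `z` (`exists_seriesB_mul_thetaSeries_eq`).
Translating the zero-sum lattice by `a e_j - (1,…,1)` shows that the Laurent coefficients of the
left side obey the same step-`a` recurrence as those of `θ(q; z)` (`mulCoeff_add`), so the ratio of
coefficients has period `a`.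

The left side also vanishes at every `z = q^k`. If `a ∣ k`, the theta factor is zero. Otherwise a
translation by `k e_j` identifies `B(q^k)`, up to a nonzero factor, with the coefficient of `y^k` in
`∏ θ(q; ω^i y)` (`thetaCoeff_mul_seriesB`), and that product is invariant under `y ↦ ω y`
(`thetaPowCoeff_eq_zero`). Since `θ(q; ·)` has no zero on the unit circle except `1`, a Fourier
transform on `ZMod a` turns these zeros into constancy of the ratio
(`eq_const_of_tsum_mul_thetaCoeff_eq_zero`).

The Jacobi triple product (`thetaSeries_eq`) converts theta series to products, and `c` is read off
as `z → 1` from `B(1) = E(q)^a / E(q^a)` (`seriesB_one_mul_eulerE`). -/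

/-! ### Theta series and theta products: recurrences, convergence, nonvanishing. -/

/-- The coefficient `(-1) ^ m * q ^ (m * (m - 1) / 2)` of the theta series. -/
noncomputable def thetaCoeff (q : ℂ) (m : ℤ) : ℂ := (-1) ^ m * q ^ (m * (m - 1) / 2)

/-- The theta series `∑ (-1) ^ m * q ^ (m * (m - 1) / 2) * z ^ m`. -/
noncomputable def thetaSeries (q z : ℂ) : ℂ := ∑' m : ℤ, thetaCoeff q m * z ^ m

/-- The theta product `∏ (1 - z * q ^ n) * (1 - z⁻¹ * q ^ (n + 1))`. -/
noncomputable def thetaProd (q z : ℂ) : ℂ :=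
  ∏' n : ℕ, (1 - z * q ^ n) * (1 - z⁻¹ * q ^ (n + 1))

theorem two_mul_half_mul_pred (m : ℤ) : 2 * (m * (m - 1) / 2) = m * (m - 1) :=
  Int.mul_ediv_cancel' (Int.even_mul_pred_self m).two_dvd

theorem half_mul_pred_add (s k : ℤ) :
    (s + k) * (s + k - 1) / 2 = s * (s - 1) / 2 + k * (k - 1) / 2 + k * s := by
  have h1 := two_mul_half_mul_pred s
  have h2 := two_mul_half_mul_pred k
  have h3 := two_mul_half_mul_pred (s + k)
  linarith

theorem thetaCoeff_zero (q : ℂ) : thetaCoeff q 0 = 1 := by simp [thetaCoeff]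

theorem thetaCoeff_one (q : ℂ) : thetaCoeff q 1 = -1 := by simp [thetaCoeff]

theorem thetaCoeff_ne_zero {q : ℂ} (hq0 : q ≠ 0) (m : ℤ) : thetaCoeff q m ≠ 0 :=
  mul_ne_zero (zpow_ne_zero _ (by simp)) (zpow_ne_zero _ hq0)

theorem thetaCoeff_add {q : ℂ} (hq0 : q ≠ 0) (s k : ℤ) :
    thetaCoeff q (s + k) = thetaCoeff q s * thetaCoeff q k * q ^ (k * s) := by
  simp only [thetaCoeff, half_mul_pred_add, zpow_add₀ hq0,
    zpow_add₀ (show (-1 : ℂ) ≠ 0 by simp)]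
  ring

theorem thetaCoeff_add_one {q : ℂ} (hq0 : q ≠ 0) (m : ℤ) :
    thetaCoeff q (m + 1) = -q ^ m * thetaCoeff q m := by
  rw [thetaCoeff_add hq0, thetaCoeff_one, one_mul]; ring

/-- The reflection `m ↦ 1 - m` keeps the exponent of `q` and flips the sign; this forces `θ(q; 1) =
0`. -/
theorem thetaCoeff_one_sub (q : ℂ) (m : ℤ) : thetaCoeff q (1 - m) = -thetaCoeff q m := by
  unfold thetaCoeff
  rw [show (1 - m) * (1 - m - 1) = m * (m - 1) by ring, zpow_sub₀ (by simp)]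
  have h : ((-1 : ℂ) ^ m)⁻¹ = (-1) ^ m := by rw [← _root_.inv_zpow]; norm_num
  rw [div_eq_mul_inv, h]; ring

theorem summable_norm_of_ratio {f r : ℕ → ℂ} (h0 : ∀ n, f n ≠ 0)
    (h : ∀ n, f (n + 1) = r n * f n) (hr : Tendsto r atTop (𝓝 0)) :
    Summable fun n => ‖f n‖ := by
  refine summable_of_ratio_test_tendsto_lt_one zero_lt_one
    (Eventually.of_forall fun n => norm_ne_zero_iff.2 (h0 n)) ?_
  refine (tendsto_norm_zero.comp hr).congr fun n => ?_
  have := norm_ne_zero_iff.2 (h0 n)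
  simp only [Function.comp, norm_norm, h, norm_mul]
  field_simp

theorem summable_norm_thetaCoeff_mul {q z : ℂ} (hq0 : q ≠ 0) (hq : ‖q‖ < 1) (hz : z ≠ 0) :
    Summable fun m : ℤ => ‖thetaCoeff q m * z ^ m‖ := by
  have hne (m : ℤ) : thetaCoeff q m * z ^ m ≠ 0 :=
    mul_ne_zero (thetaCoeff_ne_zero hq0 m) (zpow_ne_zero _ hz)
  have hpow : Tendsto (fun n : ℕ => q ^ n) atTop (𝓝 0) :=
    tendsto_pow_atTop_nhds_zero_of_norm_lt_one hq
  refine Summable.of_nat_of_neg ?_ ?_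
  · refine summable_norm_of_ratio (f := fun n : ℕ => thetaCoeff q n * z ^ (n : ℤ))
      (r := fun n => -q ^ n * z) (fun n => hne n) (fun n => ?_) ?_
    · push_cast
      rw [thetaCoeff_add_one hq0, zpow_add_one₀ hz, zpow_natCast]; ring
    · simpa using (hpow.neg).mul_const z
  · refine summable_norm_of_ratio (f := fun n : ℕ => thetaCoeff q (-n) * z ^ (-n : ℤ))
      (r := fun n => -q ^ (n + 1) * z⁻¹) (fun n => hne _) (fun n => ?_) ?_
    · have h := thetaCoeff_add_one hq0 (-(n : ℤ) - 1)
      rw [sub_add_cancel] at h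
      push_cast
      rw [h, show -((n : ℤ) + 1) = -n - 1 by ring, zpow_sub_one₀ hz,
        show (-n - 1 : ℤ) = -((n + 1 : ℕ) : ℤ) by push_cast; ring, _root_.zpow_neg q, zpow_natCast]
      have := pow_ne_zero (n + 1) hq0
      field_simp
    · simpa using ((tendsto_add_atTop_iff_nat 1).2 hpow).neg.mul_const z⁻¹

theorem norm_pow_lt_one {q : ℂ} (hq : ‖q‖ < 1) {a : ℕ} (ha : a ≠ 0) : ‖q ^ a‖ < 1 := by
  rw [norm_pow]; exact pow_lt_one₀ (norm_nonneg _) hq ha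

theorem summable_norm_mul_pow {q : ℂ} (hq : ‖q‖ < 1) (c : ℂ) :
    Summable fun n : ℕ => ‖-(c * q ^ n)‖ := by
  simp only [norm_neg, norm_mul, norm_pow]
  exact (summable_geometric_of_lt_one (norm_nonneg q) hq).mul_left _

theorem summable_norm_mul_pow_succ {q : ℂ} (hq : ‖q‖ < 1) (c : ℂ) :
    Summable fun n : ℕ => ‖-(c * q ^ (n + 1))‖ :=
  (summable_nat_add_iff 1).2 (summable_norm_mul_pow hq c)

theorem multipliable_one_sub_mul_pow {q : ℂ} (hq : ‖q‖ < 1) (c : ℂ) :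
    Multipliable fun n : ℕ => 1 - c * q ^ n := by
  simpa [sub_eq_add_neg] using multipliable_one_add_of_summable (summable_norm_mul_pow hq c)

theorem multipliable_one_sub_mul_pow_succ {q : ℂ} (hq : ‖q‖ < 1) (c : ℂ) :
    Multipliable fun n : ℕ => 1 - c * q ^ (n + 1) := by
  simpa [sub_eq_add_neg] using multipliable_one_add_of_summable (summable_norm_mul_pow_succ hq c)

theorem multipliable_thetaProd {q : ℂ} (hq : ‖q‖ < 1) (z : ℂ) :
    Multipliable fun n : ℕ => (1 - z * q ^ n) * (1 - z⁻¹ * q ^ (n + 1)) :=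
  (multipliable_one_sub_mul_pow hq z).mul (multipliable_one_sub_mul_pow_succ hq z⁻¹)

theorem thetaProd_eq_mul {q : ℂ} (hq : ‖q‖ < 1) (z : ℂ) :
    thetaProd q z = (∏' n : ℕ, (1 - z * q ^ n)) * ∏' n : ℕ, (1 - z⁻¹ * q ^ (n + 1)) :=
  (multipliable_one_sub_mul_pow hq z).tprod_mul (multipliable_one_sub_mul_pow_succ hq z⁻¹)

theorem thetaProd_ne_zero {q z : ℂ} (hq : ‖q‖ < 1)
    (h : ∀ n : ℕ, 1 - z * q ^ n ≠ 0 ∧ 1 - z⁻¹ * q ^ (n + 1) ≠ 0) : thetaProd q z ≠ 0 := by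
  rw [thetaProd_eq_mul hq]
  refine mul_ne_zero ?_ ?_
  · simpa only [sub_eq_add_neg] using tprod_one_add_ne_zero_of_summable
      (f := fun n : ℕ => -(z * q ^ n)) (fun n => by simpa [← sub_eq_add_neg] using (h n).1)
      (summable_norm_mul_pow hq z)
  · simpa only [sub_eq_add_neg] using tprod_one_add_ne_zero_of_summable
      (f := fun n : ℕ => -(z⁻¹ * q ^ (n + 1)))
      (fun n => by simpa [← sub_eq_add_neg] using (h n).2) (summable_norm_mul_pow_succ hq z⁻¹)

theorem one_sub_ne_zero_of_norm_lt_one {x : ℂ} (h : ‖x‖ < 1) : 1 - x ≠ 0 := by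
  rintro h0
  rw [← sub_eq_zero.1 h0] at h
  simp at h

theorem one_sub_pow_succ_ne_zero {q : ℂ} (hq : ‖q‖ < 1) (n : ℕ) : 1 - q ^ (n + 1) ≠ 0 :=
  one_sub_ne_zero_of_norm_lt_one (norm_pow_lt_one hq n.succ_ne_zero)

theorem thetaProd_ne_zero_of_norm_eq_one {q z : ℂ} (hq : ‖q‖ < 1) (hz : ‖z‖ = 1) (hz1 : z ≠ 1) :
    thetaProd q z ≠ 0 := by
  refine thetaProd_ne_zero hq fun n => ⟨?_, one_sub_ne_zero_of_norm_lt_one ?_⟩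
  · rcases n.eq_zero_or_pos with rfl | hn
    · simpa [sub_eq_zero] using hz1.symm
    · exact one_sub_ne_zero_of_norm_lt_one (by
        rw [norm_mul, hz, one_mul]; exact norm_pow_lt_one hq hn.ne')
  · rw [norm_mul, norm_inv, hz, inv_one, one_mul]
    exact norm_pow_lt_one hq n.succ_ne_zero

theorem eulerE_ne_zero {q : ℂ} (hq : ‖q‖ < 1) : eulerE q ≠ 0 := by
  simpa only [sub_eq_add_neg, eulerE, one_mul] using tprod_one_add_ne_zero_of_summable
      (f := fun n : ℕ => -(1 * q ^ (n + 1)))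
      (fun n => by simpa [← sub_eq_add_neg] using one_sub_pow_succ_ne_zero hq n)
      (summable_norm_mul_pow_succ hq 1)

/-! ### The Jacobi triple product. -/

/-- The finite `q`-factorial `∏_{n = 1}^N (1 - q ^ n)`. -/
noncomputable def qFact (q : ℂ) (N : ℕ) : ℂ := ∏ n ∈ Finset.range N, (1 - q ^ (n + 1))

/-- The reciprocal of the `q`-factorial, extended by zero to negative integers. -/
noncomputable def qFactInv (q : ℂ) (k : ℤ) : ℂ := if k < 0 then 0 else (qFact q k.toNat)⁻¹

theorem tendsto_qFact {q : ℂ} (hq : ‖q‖ < 1) : Tendsto (qFact q) atTop (𝓝 (eulerE q)) :=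
  (multipliable_eulerE hq).hasProd.tendsto_prod_nat

/-- Extension by zero makes the recurrence uniform in `k`: at `k = 0` the factor `1 - q^0` vanishes.
-/
theorem qFactInv_sub_one {q : ℂ} (hq : ‖q‖ < 1) (k : ℤ) :
    qFactInv q (k - 1) = (1 - q ^ k) * qFactInv q k := by
  rcases lt_trichotomy k 0 with hk | rfl | hk
  · simp [qFactInv, hk, show k - 1 < 0 by omega]
  · simp [qFactInv]
  · lift k to ℕ using hk.le
    obtain ⟨n, rfl⟩ : ∃ n, k = n + 1 := ⟨k - 1, by omega⟩
    have h := one_sub_pow_succ_ne_zero hq n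
    have h1 : ¬ ((n : ℤ) + 1 < 0) := by omega
    have h2 : ((n : ℤ) + 1).toNat = n + 1 := by omega
    simp only [qFactInv, Nat.cast_add, Nat.cast_one, add_sub_cancel_right, h1, h2,
      Int.toNat_natCast, if_false, show ¬ ((n : ℤ) < 0) by omega]
    rw [qFact, qFact, Finset.prod_range_succ, mul_inv,
      show (q ^ ((n : ℤ) + 1)) = q ^ (n + 1) by exact_mod_cast zpow_natCast q (n + 1)]
    field_simp

theorem exists_qFact_bound {q : ℂ} (hq : ‖q‖ < 1) : ∃ C, ∀ N, ‖qFact q N‖ ≤ C := by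
  obtain ⟨C, hC⟩ := (tendsto_qFact hq).norm.bddAbove_range
  exact ⟨C, fun N => hC ⟨N, rfl⟩⟩

theorem exists_qFactInv_bound {q : ℂ} (hq : ‖q‖ < 1) : ∃ C, ∀ k, ‖qFactInv q k‖ ≤ C := by
  obtain ⟨C, hC⟩ := ((tendsto_qFact hq).inv₀ (eulerE_ne_zero hq)).norm.bddAbove_range
  refine ⟨C, fun k => ?_⟩
  unfold qFactInv
  split_ifs
  · exact norm_zero.trans_le ((norm_nonneg _).trans (hC ⟨0, rfl⟩))
  · exact hC ⟨_, rfl⟩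

theorem tendsto_qFactInv {q : ℂ} (hq : ‖q‖ < 1) (m : ℤ) :
    Tendsto (fun N : ℕ => qFactInv q (N + m)) atTop (𝓝 (eulerE q)⁻¹) := by
  have h1 : Tendsto (fun N : ℕ => ((N : ℤ) + m).toNat) atTop atTop :=
    tendsto_atTop.2 fun b => by
      filter_upwards [eventually_ge_atTop (b + m.natAbs)] with N hN
      omega
  refine (((tendsto_qFact hq).inv₀ (eulerE_ne_zero hq)).comp h1).congr' ?_
  filter_upwards [eventually_ge_atTop m.natAbs] with N hN
  simp [qFactInv, show ¬ ((N : ℤ) + m < 0) by omega]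

/-- This is the coefficient identity for passing from `N` to `N + 1` factors. Every reciprocal on
the right is a multiple of `qFactInv q (N + 1 - m)` or `qFactInv q (N + 1 + m)`, leaving an identity
in powers of `q`. -/
theorem qFactInv_mul_recurrence {q : ℂ} (hq0 : q ≠ 0) (hq : ‖q‖ < 1) (N m : ℤ) :
    (1 - q ^ (2 * N + 1)) * (1 - q ^ (2 * N + 2)) *
        (qFactInv q (N + 1 - m) * qFactInv q (N + 1 + m)) =
      (1 + q ^ (2 * N + 1)) * (qFactInv q (N - m) * qFactInv q (N + m)) +
      q ^ (N + 1 - m) * (qFactInv q (N - (m - 1)) * qFactInv q (N + (m - 1))) +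
      q ^ (N + 1 + m) * (qFactInv q (N - (m + 1)) * qFactInv q (N + (m + 1))) := by
  have a1 := qFactInv_sub_one hq (N + 1 - m)
  have a2 := qFactInv_sub_one hq (N + 1 + m)
  have a3 := qFactInv_sub_one hq (N - m)
  have a4 := qFactInv_sub_one hq (N + m)
  rw [show N + 1 - m - 1 = N - m by ring] at a1
  rw [show N + 1 + m - 1 = N + m by ring] at a2
  rw [show N - (m - 1) = N + 1 - m by ring, show N + (m - 1) = N + m - 1 by ring,
    show N - (m + 1) = N - m - 1 by ring, show N + (m + 1) = N + 1 + m by ring, a3, a4, a1, a2]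
  rw [show 2 * N + 1 = N + N + 1 by ring, show 2 * N + 2 = N + N + 1 + 1 by ring]
  simp only [zpow_add₀ hq0, zpow_sub₀ hq0, zpow_one]
  have := zpow_ne_zero m hq0
  field_simp
  ring

/-- The finite form of the Jacobi triple product identity. -/
theorem hasSum_finite_tripleProduct {q z : ℂ} (hq0 : q ≠ 0) (hq : ‖q‖ < 1) (hz : z ≠ 0) (N : ℕ) :
    HasSum (fun m : ℤ => thetaCoeff q m * z ^ m *
        (qFact q (2 * N) * (qFactInv q (N - m) * qFactInv q (N + m))))
      (∏ n ∈ Finset.range N, (1 - z * q ^ n) * (1 - z⁻¹ * q ^ (n + 1))) := by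
  induction N with
  | zero =>
    have h : ∀ m : ℤ, m ≠ 0 → thetaCoeff q m * z ^ m *
        (qFact q (2 * 0) * (qFactInv q ((0 : ℕ) - m) * qFactInv q ((0 : ℕ) + m))) = 0 := by
      intro m hm
      rcases lt_or_gt_of_ne hm with h | h
      · simp [qFactInv, h]
      · simp [qFactInv, h]
    convert hasSum_single (0 : ℤ) h using 1
    simp [qFactInv, qFact, thetaCoeff]
  | succ N ih =>
    -- Multiplication by `z` and by `z⁻¹` shifts the summation index by one in either direction.
    have h1 := (Equiv.subRight (1 : ℤ)).hasSum_iff.2 ih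
    have h2 := (Equiv.addRight (1 : ℤ)).hasSum_iff.2 ih
    have h := ((ih.mul_left (1 + q ^ (2 * N + 1))).sub (h1.mul_left (z * q ^ N))).sub
      (h2.mul_left (z⁻¹ * q ^ (N + 1)))
    have hP : (1 - z * q ^ N) * (1 - z⁻¹ * q ^ (N + 1)) =
        1 + q ^ (2 * N + 1) - z * q ^ N - z⁻¹ * q ^ (N + 1) := by
      rw [show 2 * N + 1 = N + (N + 1) by ring]
      linear_combination (q ^ (N + (N + 1))) * mul_inv_cancel₀ hz
    rw [← sub_mul, ← sub_mul, ← hP] at h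
    rw [Finset.prod_range_succ, mul_comm (∏ n ∈ Finset.range N, _)]
    refine Eq.mpr (congrArg (fun f => HasSum f _) (funext fun m => ?_)) h
    have hr := qFactInv_mul_recurrence hq0 hq N m
    have hf : qFact q (2 * (N + 1)) =
        qFact q (2 * N) * ((1 - q ^ (2 * N + 1)) * (1 - q ^ (2 * N + 2))) := by
      rw [qFact, show 2 * (N + 1) = 2 * N + 1 + 1 by ring, Finset.prod_range_succ,
        Finset.prod_range_succ, qFact]
      ring
    have e1 : q ^ (2 * (N : ℤ) + 1) = q ^ (2 * N + 1) := by
      exact_mod_cast zpow_natCast q (2 * N + 1)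
    have e2 : q ^ (2 * (N : ℤ) + 2) = q ^ (2 * N + 2) := by
      exact_mod_cast zpow_natCast q (2 * N + 2)
    have t1 := thetaCoeff_add_one hq0 (m - 1)
    rw [sub_add_cancel] at t1
    have t2 := thetaCoeff_add_one hq0 m
    have t1' : thetaCoeff q (m - 1) = -q ^ (1 - m) * thetaCoeff q m := by
      rw [t1, show 1 - m = -(m - 1) by ring, _root_.zpow_neg]
      have := zpow_ne_zero (m - 1) hq0
      field_simp
    rw [e1, e2] at hr
    simp only [Function.comp, Equiv.subRight_apply, Equiv.coe_addRight, hf, Nat.cast_add,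
      Nat.cast_one, t1', t2, zpow_sub_one₀ hz, zpow_add_one₀ hz]
    rw [show (N : ℤ) + 1 - m = N + (1 - m) by ring] at hr ⊢
    rw [zpow_add₀ hq0 N, add_assoc (N : ℤ) 1 m, zpow_add₀ hq0 N, add_comm 1 m,
      zpow_add_one₀ hq0, zpow_natCast] at hr
    rw [add_assoc (N : ℤ) 1 m, add_comm 1 m]
    set X := qFactInv q (N + (1 - m)) * qFactInv q (N + (m + 1)) with hX
    set A := qFactInv q (N - (m - 1)) * qFactInv q (N + (m - 1))
    set B := qFactInv q (N - (m + 1)) * qFactInv q (N + (m + 1))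
    set C := qFactInv q (N - m) * qFactInv q (N + m)
    have : z * z⁻¹ = 1 := mul_inv_cancel₀ hz
    linear_combination thetaCoeff q m * z ^ m * qFact q (2 * N) * hr -
      thetaCoeff q m * z ^ m * qFact q (2 * N) *
        (q ^ N * q ^ (1 - m) * A + q ^ N * q * q ^ m * B) * this

/-- The Jacobi triple product identity. -/
theorem thetaSeries_eq {q z : ℂ} (hq0 : q ≠ 0) (hq : ‖q‖ < 1) (hz : z ≠ 0) :
    thetaSeries q z = eulerE q * thetaProd q z := by
  have hE := eulerE_ne_zero hq
  obtain ⟨C, hC⟩ := exists_qFact_bound hq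
  obtain ⟨D, hD⟩ := exists_qFactInv_bound hq
  have hC0 : 0 ≤ C := (norm_nonneg _).trans (hC 0)
  have hD0 : 0 ≤ D := (norm_nonneg _).trans (hD 0)
  have hlim : Tendsto (fun N : ℕ => ∑' m : ℤ, thetaCoeff q m * z ^ m *
        (qFact q (2 * N) * (qFactInv q (N - m) * qFactInv q (N + m)))) atTop
      (𝓝 (∑' m : ℤ, thetaCoeff q m * z ^ m *
        (eulerE q * ((eulerE q)⁻¹ * (eulerE q)⁻¹)))) := by
    -- Let `N → ∞` in the finite identity; the `q`-factorial weights are bounded by `C * (D * D)`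
    -- uniformly in `N` and `m`.
    refine tendsto_tsum_of_dominated_convergence
      ((summable_norm_thetaCoeff_mul hq0 hq hz).mul_right (C * (D * D))) (fun m => ?_)
      (Eventually.of_forall fun N m => ?_)
    · refine Tendsto.const_mul _ (Tendsto.mul ?_ (Tendsto.mul ?_ (tendsto_qFactInv hq m)))
      · exact (tendsto_qFact hq).comp (tendsto_id.const_mul_atTop' two_pos)
      · simpa [sub_eq_add_neg] using tendsto_qFactInv hq (-m)
    · rw [norm_mul _ (_ * (_ * _)), norm_mul (qFact _ _), norm_mul (qFactInv _ _)]
      gcongr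
      exacts [hC _, hD _, hD _]
  have h2 : Tendsto (fun N : ℕ => ∑' m : ℤ, thetaCoeff q m * z ^ m *
        (qFact q (2 * N) * (qFactInv q (N - m) * qFactInv q (N + m)))) atTop
      (𝓝 (thetaProd q z)) := by
    refine (multipliable_thetaProd hq z).hasProd.tendsto_prod_nat.congr fun N => ?_
    exact (hasSum_finite_tripleProduct hq0 hq hz N).tsum_eq.symm
  rw [tendsto_nhds_unique h2 hlim, tsum_mul_right, thetaSeries]
  field_simp

/-! ### Lattice coefficients under translation and cyclic rotation. -/

theorem zpow_finset_sum {ι : Type*} {x : ℂ} (hx : x ≠ 0) (s : Finset ι) (f : ι → ℤ) :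
    x ^ (∑ i ∈ s, f i) = ∏ i ∈ s, x ^ f i := by
  classical
  induction s using Finset.induction_on with
  | empty => simp
  | insert i s hi ih => rw [Finset.sum_insert hi, Finset.prod_insert hi, zpow_add₀ hx, ih]

theorem summable_norm_and_tsum_pi_prod {β : Type*} {a : ℕ} {f : Fin a → β → ℂ}
    (hf : ∀ i, Summable fun b => ‖f i b‖) :
    Summable (fun n : Fin a → β => ‖∏ i, f i (n i)‖) ∧
      ∑' n : Fin a → β, ∏ i, f i (n i) = ∏ i, ∑' b, f i b := by
  induction a with
  | zero =>
    refine ⟨Summable.of_finite, ?_⟩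
    simp
  | succ a ih =>
    obtain ⟨h1, h2⟩ := ih fun i => hf i.succ
    have he (x : β × (Fin a → β)) : ∏ i, f i (Fin.consEquiv (fun _ => β) x i) =
        f 0 x.1 * ∏ i : Fin a, f i.succ (x.2 i) := by
      rw [Fin.prod_univ_succ]; simp [Fin.consEquiv]
    constructor
    · rw [← (Fin.consEquiv fun _ => β).summable_iff]
      refine ((hf 0).mul_norm h1).congr fun x => ?_
      simp only [Function.comp, he]
    · rw [← (Fin.consEquiv fun _ => β).tsum_eq]
      simp only [he]
      rw [← tsum_mul_tsum_of_summable_norm (hf 0) h1, h2, Fin.prod_univ_succ]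

theorem isPrimitiveRoot_rootω {a : ℕ} (ha : a ≠ 0) : IsPrimitiveRoot (rootω a) a :=
  Complex.isPrimitiveRoot_exp a ha

theorem rootω_ne_zero (a : ℕ) : rootω a ≠ 0 := Complex.exp_ne_zero _

/-- The exponents add up to `a(a-1)/2`, so the product is `exp(πi(a-1))`; `a + 1` has the same
parity as `a - 1`. -/
theorem prod_rootω_pow {a : ℕ} (ha : a ≠ 0) : ∏ i : Fin a, rootω a ^ (i : ℕ) = (-1) ^ (a + 1) := by
  rw [Finset.prod_pow_eq_pow_sum, Fin.sum_univ_eq_sum_range (fun i => i), rootω,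
    ← Complex.exp_nat_mul]
  have h := Finset.sum_range_id_mul_two a
  obtain ⟨b, rfl⟩ := Nat.exists_eq_succ_of_ne_zero ha
  have h' : ((∑ i ∈ Finset.range b.succ, i : ℕ) : ℂ) * 2 = (b.succ : ℂ) * b := by
    exact_mod_cast h
  have hb : (b.succ : ℂ) ≠ 0 := by exact_mod_cast ha
  have : ((∑ i ∈ Finset.range b.succ, i : ℕ) : ℂ) * (2 * Real.pi * Complex.I / b.succ) =
      (b : ℕ) * (Real.pi * Complex.I) := by
    field_simp
    linear_combination h'
  rw [this, Complex.exp_nat_mul, Complex.exp_pi_mul_I, Nat.succ_eq_add_one, pow_succ, pow_succ]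
  ring

/-- The coefficient of the product of `a` theta series at the roots of unity. -/
noncomputable def latticeCoeff {a : ℕ} (q : ℂ) (n : Fin a → ℤ) : ℂ :=
  ∏ i : Fin a, (rootω a ^ (i : ℕ)) ^ n i * thetaCoeff q (n i)

theorem rootω_zpow_bVec {a : ℕ} (n : Fin a → ℤ) :
    rootω a ^ (bVec a ⬝ᵥ n) = ∏ i : Fin a, (rootω a ^ (i : ℕ)) ^ n i := by
  rw [dotProduct, zpow_finset_sum (rootω_ne_zero a)]
  refine Finset.prod_congr rfl fun i _ => ?_
  rw [bVec, _root_.zpow_mul, zpow_natCast]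

/-- On zero-sum vectors the linear part of `∑ n_i(n_i-1)/2` drops out and the signs multiply to `1`.
-/
theorem termB_eq {a : ℕ} (j : Fin a) (z : ℂ) {q : ℂ} (hq0 : q ≠ 0) (n : ZeroSumVec a) :
    termB j z q n = z ^ (n.1 j) * latticeCoeff q n.1 := by
  have h0 : ∑ i, n.1 i = 0 := by simpa [dotProduct] using n.2
  have hs : (n.1 ⬝ᵥ n.1) / 2 = ∑ i, n.1 i * (n.1 i - 1) / 2 := by
    have h1 : 2 * ∑ i, n.1 i * (n.1 i - 1) / 2 = n.1 ⬝ᵥ n.1 := by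
      simp only [Finset.mul_sum, two_mul_half_mul_pred]
      simp only [mul_sub, mul_one, Finset.sum_sub_distrib, h0, dotProduct, sub_zero]
    omega
  rw [termB, latticeCoeff, Finset.prod_mul_distrib, rootω_zpow_bVec, hs, zpow_finset_sum hq0]
  simp only [thetaCoeff, Finset.prod_mul_distrib]
  rw [← zpow_finset_sum (x := -1) (by simp), h0]
  ring

/-- The roots of unity contribute `(-1)^(a+1)` and the theta coefficients `(-1)^a`, hence a single
minus sign for every `a`. -/
theorem latticeCoeff_add_one {a : ℕ} (ha : a ≠ 0) {q : ℂ} (hq0 : q ≠ 0) (n : Fin a → ℤ) :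
    latticeCoeff q (n + 1) = -q ^ (n ⬝ᵥ 1) * latticeCoeff q n := by
  have h (i : Fin a) : (rootω a ^ (i : ℕ)) ^ (n + 1) i * thetaCoeff q ((n + 1) i) =
      (rootω a ^ (i : ℕ)) * ((-1) * q ^ n i) *
        ((rootω a ^ (i : ℕ)) ^ n i * thetaCoeff q (n i)) := by
    rw [Pi.add_apply, Pi.one_apply, thetaCoeff_add_one hq0,
      zpow_add_one₀ (pow_ne_zero _ (rootω_ne_zero a))]
    ring
  rw [latticeCoeff, Finset.prod_congr rfl fun i _ => h i, Finset.prod_mul_distrib,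
    Finset.prod_mul_distrib, prod_rootω_pow ha, Finset.prod_mul_distrib, ← zpow_finset_sum hq0,
    latticeCoeff]
  simp only [Finset.prod_const, Finset.card_univ, Fintype.card_fin, dotProduct, Pi.one_apply,
    mul_one]
  rw [← mul_assoc, ← pow_add, show a + 1 + a = 2 * a + 1 by ring, pow_succ, pow_mul]
  simp

theorem latticeCoeff_add_single {a : ℕ} (j : Fin a) {q : ℂ} (hq0 : q ≠ 0) (n : Fin a → ℤ) (k : ℤ) :
    latticeCoeff q (n + Pi.single j k) =
      (rootω a ^ (j : ℕ)) ^ k * thetaCoeff q k * q ^ (k * n j) * latticeCoeff q n := by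
  rw [latticeCoeff, latticeCoeff, ← Finset.mul_prod_erase _ _ (Finset.mem_univ j),
    ← Finset.mul_prod_erase _ (fun i : Fin a => (rootω a ^ (i : ℕ)) ^ n i * thetaCoeff q (n i))
      (Finset.mem_univ j)]
  have h : ∀ i ∈ Finset.univ.erase j, (rootω a ^ (i : ℕ)) ^ (n + Pi.single j k : Fin a → ℤ) i *
      thetaCoeff q ((n + Pi.single j k : Fin a → ℤ) i) =
        (rootω a ^ (i : ℕ)) ^ n i * thetaCoeff q (n i) := by
    intro i hi
    simp [Pi.single_eq_of_ne (Finset.ne_of_mem_erase hi)]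
  rw [Finset.prod_congr rfl h]
  simp only [Pi.add_apply, Pi.single_eq_same]
  rw [thetaCoeff_add hq0, zpow_add₀ (pow_ne_zero _ (rootω_ne_zero a))]
  ring

theorem rootω_pow_val_add_one {a : ℕ} [NeZero a] (i : Fin a) :
    rootω a ^ ((i + 1 : Fin a) : ℕ) = rootω a ^ (i : ℕ) * rootω a := by
  have h := (isPrimitiveRoot_rootω (NeZero.ne a)).pow_eq_one
  rw [Fin.val_add, ← pow_eq_pow_mod _ h, pow_add, Fin.val_one', ← pow_eq_pow_mod _ h, pow_one]

theorem latticeCoeff_comp_sub_one {a : ℕ} [NeZero a] (q : ℂ) (n : Fin a → ℤ) :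
    latticeCoeff q (fun i => n (i - 1)) = rootω a ^ (n ⬝ᵥ 1) * latticeCoeff q n := by
  rw [latticeCoeff, ← Equiv.prod_comp (Equiv.addRight (1 : Fin a))]
  simp only [Equiv.coe_addRight, add_sub_cancel_right, rootω_pow_val_add_one, _root_.mul_zpow]
  rw [latticeCoeff, dotProduct, zpow_finset_sum (rootω_ne_zero a), ← Finset.prod_mul_distrib]
  refine Finset.prod_congr rfl fun i _ => ?_
  simp only [Pi.one_apply, mul_one]
  ring

/-! ### The product of theta series at the roots of unity. -/

/-- The coefficient of `y ^ s` in the product `∏ i, thetaSeries q (ω ^ i * y)`. -/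
noncomputable def thetaPowCoeff (a : ℕ) (q : ℂ) (s : ℤ) : ℂ :=
  ∑' n : {n : Fin a → ℤ // n ⬝ᵥ 1 = s}, latticeCoeff q n.1

theorem thetaPowCoeff_eq_zero {a : ℕ} (ha : a ≠ 0) (q : ℂ) {s : ℤ} (hs : ¬ (a : ℤ) ∣ s) :
    thetaPowCoeff a q s = 0 := by
  have : NeZero a := ⟨ha⟩
  let e : {n : Fin a → ℤ // n ⬝ᵥ 1 = s} ≃ {n : Fin a → ℤ // n ⬝ᵥ 1 = s} :=
    ((Equiv.addRight (1 : Fin a)).arrowCongr (Equiv.refl ℤ)).subtypeEquiv fun n => by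
      have h : ∑ i, n (i - 1) = ∑ i, n i := (Equiv.subRight (1 : Fin a)).sum_comp n
      simp [dotProduct, Equiv.arrowCongr, ← sub_eq_add_neg, h]
  have he (n : {n : Fin a → ℤ // n ⬝ᵥ 1 = s}) :
      latticeCoeff q (e n).1 = rootω a ^ s * latticeCoeff q n.1 := by
    have h := latticeCoeff_comp_sub_one q n.1
    rw [n.2] at h
    rw [← h]
    congr 1
    funext i
    simp [e, Equiv.arrowCongr, sub_eq_add_neg]
  have h : thetaPowCoeff a q s = rootω a ^ s * thetaPowCoeff a q s := by
    conv_lhs => rw [thetaPowCoeff, ← e.tsum_eq]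
    simp only [he]
    rw [tsum_mul_left, thetaPowCoeff]
  have h1 : rootω a ^ s ≠ 1 := fun h1 =>
    hs (((isPrimitiveRoot_rootω ha).zpow_eq_one_iff_dvd s).1 h1)
  have h2 : (1 - rootω a ^ s) * thetaPowCoeff a q s = 0 := by linear_combination h
  exact (mul_eq_zero.1 h2).resolve_left (sub_ne_zero.2 h1.symm)

theorem thetaPowCoeff_add {a : ℕ} (ha : a ≠ 0) {q : ℂ} (hq0 : q ≠ 0) (s : ℤ) :
    thetaPowCoeff a q (s + a) = -q ^ s * thetaPowCoeff a q s := by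
  let e : {n : Fin a → ℤ // n ⬝ᵥ 1 = s} ≃ {n : Fin a → ℤ // n ⬝ᵥ 1 = s + a} :=
    (Equiv.addRight (1 : Fin a → ℤ)).subtypeEquiv fun n => by
      simp [add_dotProduct]
  rw [thetaPowCoeff, ← e.tsum_eq, thetaPowCoeff, ← tsum_mul_left]
  refine tsum_congr fun n => ?_
  have h := latticeCoeff_add_one ha hq0 n.1
  rw [n.2] at h
  exact h

theorem thetaPowCoeff_mul {a : ℕ} (ha : a ≠ 0) {q : ℂ} (hq0 : q ≠ 0) (m : ℤ) :
    thetaPowCoeff a q (a * m) = thetaPowCoeff a q 0 * thetaCoeff (q ^ a) m := by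
  have hp : q ^ a ≠ 0 := pow_ne_zero _ hq0
  have hstep (m : ℤ) : thetaPowCoeff a q (a * (m + 1)) =
      -(q ^ a) ^ m * thetaPowCoeff a q (a * m) := by
    rw [mul_add, mul_one, thetaPowCoeff_add ha hq0, _root_.zpow_mul, zpow_natCast]
  induction m with
  | zero => simp [thetaCoeff_zero]
  | succ m ih => rw [hstep, ih, thetaCoeff_add_one hp]; ring
  | pred m ih =>
    have h1 := hstep (-m - 1)
    have h2 := thetaCoeff_add_one hp (-m - 1)
    rw [sub_add_cancel] at h1 h2
    have h3 := zpow_ne_zero (-(m : ℤ) - 1) hp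
    rw [h1, h2] at ih
    refine mul_left_cancel₀ (neg_ne_zero.2 h3) ?_
    rw [ih]; ring

theorem summable_norm_prod_thetaCoeff {a : ℕ} {q : ℂ} (hq0 : q ≠ 0) (hq : ‖q‖ < 1) {u : Fin a → ℂ}
    (hu : ∀ i, u i ≠ 0) :
    Summable fun n : Fin a → ℤ => ‖∏ i, thetaCoeff q (n i) * u i ^ n i‖ :=
  (summable_norm_and_tsum_pi_prod (f := fun i m => thetaCoeff q m * u i ^ m)
    fun i => summable_norm_thetaCoeff_mul hq0 hq (hu i)).1

/-- Group the expanded product by coordinate sum: only multiples of `a` survive, and translation by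
`(1,…,1)` determines their coefficients from the one at `0`. -/
theorem prod_thetaSeries {a : ℕ} (ha : a ≠ 0) {q y : ℂ} (hq0 : q ≠ 0) (hq : ‖q‖ < 1) (hy : y ≠ 0) :
    ∏ i : Fin a, thetaSeries q (rootω a ^ (i : ℕ) * y) =
      thetaPowCoeff a q 0 * thetaSeries (q ^ a) (y ^ a) := by
  have hu (i : Fin a) : rootω a ^ (i : ℕ) * y ≠ 0 :=
    mul_ne_zero (pow_ne_zero _ (rootω_ne_zero a)) hy
  have hterm (n : Fin a → ℤ) :
      ∏ i : Fin a, thetaCoeff q (n i) * (rootω a ^ (i : ℕ) * y) ^ n i =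
        latticeCoeff q n * y ^ (n ⬝ᵥ 1) := by
    rw [latticeCoeff, dotProduct, zpow_finset_sum hy, ← Finset.prod_mul_distrib]
    refine Finset.prod_congr rfl fun i _ => ?_
    rw [_root_.mul_zpow]; simp only [Pi.one_apply, mul_one]; ring
  have h2 := (summable_norm_and_tsum_pi_prod
    (f := fun (i : Fin a) m => thetaCoeff q m * (rootω a ^ (i : ℕ) * y) ^ m)
    fun i => summable_norm_thetaCoeff_mul hq0 hq (hu i)).2
  have h1 := (summable_norm_prod_thetaCoeff hq0 hq hu).of_norm
  simp only [hterm] at h1 h2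
  simp only [thetaSeries, ← h2]
  rw [← (Equiv.sigmaFiberEquiv fun n : Fin a → ℤ => n ⬝ᵥ 1).tsum_eq, Summable.tsum_sigma]
  · have h3 (s : ℤ) : ∑' c : {n : Fin a → ℤ // n ⬝ᵥ 1 = s},
        latticeCoeff q ((Equiv.sigmaFiberEquiv fun n : Fin a → ℤ => n ⬝ᵥ 1) ⟨s, c⟩) *
          y ^ (((Equiv.sigmaFiberEquiv fun n : Fin a → ℤ => n ⬝ᵥ 1) ⟨s, c⟩) ⬝ᵥ 1) =
        thetaPowCoeff a q s * y ^ s := by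
      rw [thetaPowCoeff, ← tsum_mul_right]
      refine tsum_congr fun n => ?_
      simp only [Equiv.sigmaFiberEquiv_apply, n.2]
    simp only [h3]
    have hinj : Function.Injective fun m : ℤ => (a : ℤ) * m :=
      mul_right_injective₀ (by exact_mod_cast ha)
    rw [← hinj.tsum_eq, ← tsum_mul_left]
    · refine tsum_congr fun m => ?_
      rw [thetaPowCoeff_mul ha hq0, _root_.zpow_mul, zpow_natCast, mul_assoc]
    · intro s hs
      by_contra hne
      refine hs ?_
      simp only [thetaPowCoeff_eq_zero ha q (s := s) fun ⟨c, hc⟩ => hne ⟨c, hc.symm⟩, zero_mul]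
  · exact ((Equiv.sigmaFiberEquiv fun n : Fin a → ℤ => n ⬝ᵥ 1).summable_iff
      (f := fun n => latticeCoeff q n * y ^ (n ⬝ᵥ 1))).2 h1

/-! ### Convergence of the series and its values at powers of `q`. -/

theorem summable_norm_zpow_mul_latticeCoeff {a : ℕ} (j : Fin a) {q z : ℂ} (hq0 : q ≠ 0)
    (hq : ‖q‖ < 1) (hz : z ≠ 0) :
    Summable fun n : Fin a → ℤ => ‖z ^ n j * latticeCoeff q n‖ := by
  refine (summable_norm_prod_thetaCoeff hq0 hq
    (u := fun i => rootω a ^ (i : ℕ) * if i = j then z else 1) fun i => mul_ne_zero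
      (pow_ne_zero _ (rootω_ne_zero a)) (by split_ifs <;> simp [hz])).congr fun n => ?_
  congr 1
  have : z ^ n j = ∏ i, (if i = j then z else 1) ^ n i := by
    rw [Finset.prod_eq_single j] <;> simp +contextual
  rw [this, latticeCoeff, ← Finset.prod_mul_distrib]
  refine Finset.prod_congr rfl fun i _ => ?_
  rw [_root_.mul_zpow]; ring

theorem summable_norm_termB {a : ℕ} (j : Fin a) {q z : ℂ} (hq0 : q ≠ 0) (hq : ‖q‖ < 1)
    (hz : z ≠ 0) : Summable fun n => ‖termB j z q n‖ := by
  simp only [termB_eq j z hq0]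
  exact (summable_norm_zpow_mul_latticeCoeff j hq0 hq hz).comp_injective
    Subtype.val_injective

/-- Adding `k e_j` to a zero-sum vector produces the factor `q^(k n_j)`, which is exactly `z^(n_j)`
at `z = q^k`. -/
theorem thetaCoeff_mul_seriesB {a : ℕ} (j : Fin a) {q : ℂ} (hq0 : q ≠ 0) (k : ℤ) :
    (rootω a ^ (j : ℕ)) ^ k * thetaCoeff q k * seriesB j (q ^ k) q = thetaPowCoeff a q k := by
  let e : ZeroSumVec a ≃ {n : Fin a → ℤ // n ⬝ᵥ 1 = k} :=
    (Equiv.addRight (Pi.single j k : Fin a → ℤ)).subtypeEquiv fun n => by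
      simp [add_dotProduct]
  rw [thetaPowCoeff, ← e.tsum_eq, seriesB, ← tsum_mul_left]
  refine tsum_congr fun n => ?_
  have h := latticeCoeff_add_single j hq0 n.1 k
  rw [termB_eq j _ hq0, ← _root_.zpow_mul]
  refine Eq.trans ?_ h.symm
  ring

theorem seriesB_one {a : ℕ} (j : Fin a) {q : ℂ} (hq0 : q ≠ 0) :
    seriesB j 1 q = thetaPowCoeff a q 0 := by
  simpa [thetaCoeff_zero] using thetaCoeff_mul_seriesB j hq0 0

theorem seriesB_zpow_eq_zero {a : ℕ} (ha : a ≠ 0) (j : Fin a) {q : ℂ} (hq0 : q ≠ 0) {k : ℤ}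
    (hk : ¬ (a : ℤ) ∣ k) : seriesB j (q ^ k) q = 0 := by
  have h := thetaCoeff_mul_seriesB j hq0 k
  rw [thetaPowCoeff_eq_zero ha q hk] at h
  exact (mul_eq_zero.1 h).resolve_left (mul_ne_zero
    (zpow_ne_zero _ (pow_ne_zero _ (rootω_ne_zero a))) (thetaCoeff_ne_zero hq0 k))

theorem prod_one_sub_primitiveRoot_pow_mul {a : ℕ} (ha : a ≠ 0) {ζ : ℂ} (hζ : IsPrimitiveRoot ζ a)
    (x : ℂ) : ∏ i : Fin a, (1 - ζ ^ (i : ℕ) * x) = 1 - x ^ a := by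
  have h := congrArg (Polynomial.eval 1)
    (X_pow_sub_C_eq_prod hζ (α := x) (Nat.pos_of_ne_zero ha) rfl)
  rw [Polynomial.eval_prod, ← Fin.prod_univ_eq_prod_range
    (fun i => Polynomial.eval 1 (Polynomial.X - Polynomial.C (ζ ^ i * x)))] at h
  simpa using h.symm

theorem prod_thetaProd {a : ℕ} (ha : a ≠ 0) {q : ℂ} (hq : ‖q‖ < 1) (y : ℂ) :
    ∏ i : Fin a, thetaProd q (rootω a ^ (i : ℕ) * y) = thetaProd (q ^ a) (y ^ a) := by
  have hω := isPrimitiveRoot_rootω ha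
  simp only [thetaProd]
  rw [← Multipliable.tprod_finsetProd fun i _ => multipliable_thetaProd hq _]
  refine tprod_congr fun n => ?_
  rw [Finset.prod_mul_distrib]
  congr 1
  · simp only [mul_assoc]
    rw [prod_one_sub_primitiveRoot_pow_mul ha hω]
    ring
  · simp only [mul_inv, mul_assoc, ← _root_.inv_pow]
    rw [prod_one_sub_primitiveRoot_pow_mul ha hω.inv]
    ring

/-- Comparing `prod_thetaSeries` with the triple product leaves this identity times a common theta
product. -/
theorem seriesB_one_mul_eulerE {a : ℕ} (ha : a ≠ 0) (j : Fin a) {q : ℂ} (hq0 : q ≠ 0)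
    (hq : ‖q‖ < 1) : seriesB j 1 q * eulerE (q ^ a) = eulerE q ^ a := by
  -- With `y^a = -1` the common theta product is evaluated at `-1`, where it is nonzero and can be
  -- cancelled.
  obtain ⟨y, hy⟩ := IsAlgClosed.exists_pow_nat_eq (-1 : ℂ) (Nat.pos_of_ne_zero ha)
  have hy0 : y ≠ 0 := by
    rintro rfl
    simp [zero_pow ha] at hy
  have hp := norm_pow_lt_one hq ha
  have h := prod_thetaSeries ha hq0 hq hy0
  have hT : thetaProd (q ^ a) (-1) ≠ 0 :=
    thetaProd_ne_zero_of_norm_eq_one hp (by simp) (by norm_num)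
  rw [Finset.prod_congr rfl fun i _ => thetaSeries_eq hq0 hq
    (mul_ne_zero (pow_ne_zero _ (rootω_ne_zero a)) hy0), Finset.prod_mul_distrib,
    prod_thetaProd ha hq, hy, thetaSeries_eq (pow_ne_zero a hq0) hp (by simp),
    ← seriesB_one j hq0] at h
  simp only [Finset.prod_const, Finset.card_univ, Fintype.card_fin] at h
  exact mul_right_cancel₀ hT (by rw [h]; ring)

/-! ### Proportionality of `B(z) θ(q^a; z)` and `θ(q; z)`. -/

theorem thetaSeries_one {q : ℂ} : thetaSeries q 1 = 0 := by
  have h : thetaSeries q 1 = -thetaSeries q 1 := by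
    conv_lhs => rw [thetaSeries, ← (Equiv.subLeft (1 : ℤ)).tsum_eq]
    simp only [Equiv.subLeft_apply, thetaCoeff_one_sub, _root_.one_zpow, mul_one, tsum_neg, thetaSeries]
  exact self_eq_neg.1 h

theorem thetaSeries_zpow {q : ℂ} (hq0 : q ≠ 0) (l : ℤ) : thetaSeries q (q ^ l) = 0 := by
  refine (mul_eq_zero.1 ?_).resolve_left (thetaCoeff_ne_zero hq0 l)
  rw [← thetaSeries_one (q := q), thetaSeries, thetaSeries, ← tsum_mul_left,
    ← (Equiv.addRight l).tsum_eq (fun m => thetaCoeff q m * 1 ^ m)]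
  refine tsum_congr fun m => ?_
  rw [Equiv.coe_addRight, thetaCoeff_add hq0, ← _root_.zpow_mul, _root_.one_zpow]
  ring

theorem summable_norm_thetaCoeff {q : ℂ} (hq0 : q ≠ 0) (hq : ‖q‖ < 1) :
    Summable fun m : ℤ => ‖thetaCoeff q m‖ := by
  simpa using summable_norm_thetaCoeff_mul hq0 hq one_ne_zero

open ZMod in
/-- A function on `ZMod a` whose translates all annihilate the theta coefficients is constant. -/
theorem eq_const_of_tsum_mul_thetaCoeff_eq_zero {a : ℕ} [NeZero a] {q : ℂ} (hq0 : q ≠ 0)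
    (hq : ‖q‖ < 1) {lam : ZMod a → ℂ}
    (h : ∀ k : ℤ, ∑' s : ℤ, lam (s - k) * thetaCoeff q s = 0) (r : ZMod a) : lam r = lam 0 := by
  have hdft (t : ZMod a) (ht : t ≠ 0) : dft lam t = 0 := by
    have hχ1 : stdAddChar t ≠ (1 : ℂ) := by
      rw [← AddChar.map_zero_eq_one (stdAddChar (N := a))]
      exact fun h0 => ht (injective_stdAddChar h0)
    have hne : thetaSeries q (stdAddChar t) ≠ 0 := by
      have hn : ‖stdAddChar t‖ = 1 := AddChar.norm_apply _ _
      rw [thetaSeries_eq hq0 hq (norm_ne_zero_iff.1 (by rw [hn]; simp))]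
      exact mul_ne_zero (eulerE_ne_zero hq) (thetaProd_ne_zero_of_norm_eq_one hq hn hχ1)
    refine (mul_eq_zero.1 ?_).resolve_right hne
    have hs (k : ZMod a) : Summable fun s : ℤ =>
        stdAddChar (k * t) * (lam (s - k) * thetaCoeff q s) := by
      refine Summable.mul_left _ (Summable.of_norm_bounded
        ((summable_norm_thetaCoeff hq0 hq).mul_left (∑ i, ‖lam i‖)) fun s => ?_)
      rw [norm_mul]
      gcongr
      exact Finset.single_le_sum (f := fun i => ‖lam i‖) (fun i _ => norm_nonneg _)
        (Finset.mem_univ _)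
    -- Weight the `k`-th vanishing relation by the character at `k * t` and sum over `k`; the
    -- substitution `k ↦ s - k` factors the double sum.
    calc dft lam t * thetaSeries q (stdAddChar t)
        = ∑' s : ℤ, ∑ k : ZMod a, stdAddChar (k * t) * (lam (s - k) * thetaCoeff q s) := by
          rw [thetaSeries, ← tsum_mul_left]
          refine tsum_congr fun s => ?_
          rw [← (Equiv.subLeft (s : ZMod a)).sum_comp, dft_apply, Finset.sum_mul]
          refine Finset.sum_congr rfl fun k _ => ?_
          rw [Equiv.subLeft_apply, sub_sub_cancel, ← AddChar.map_zsmul_eq_zpow, zsmul_eq_mul,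
            smul_eq_mul]
          have hexp : stdAddChar (((s : ZMod a) - k) * t) =
              stdAddChar (-(k * t)) * stdAddChar ((s : ZMod a) * t) := by
            rw [← AddChar.map_add_eq_mul]; ring_nf
          rw [hexp]
          ring
      _ = 0 := by
          rw [Summable.tsum_finsetSum fun k _ => hs k]
          refine Finset.sum_eq_zero fun k _ => ?_
          have := h k.cast
          rw [intCast_zmod_cast] at this
          rw [tsum_mul_left, this, mul_zero]
  -- Fourier inversion: only the zero frequency remains.
  have hinv (r : ZMod a) : lam r = (a : ℂ)⁻¹ * dft lam 0 := by
    conv_lhs => rw [← dft.symm_apply_apply lam, invDFT_apply]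
    rw [Finset.sum_eq_single 0 (fun j _ hj => by rw [hdft j hj, smul_zero]) (by simp)]
    simp
  rw [hinv r, hinv 0]

/-- The coefficient of `z ^ s` in `seriesB j z q * thetaSeries (q ^ a) z`. -/
noncomputable def mulCoeff {a : ℕ} (j : Fin a) (q : ℂ) (s : ℤ) : ℂ :=
  ∑' n : ZeroSumVec a, latticeCoeff q n.1 * thetaCoeff (q ^ a) (s - n.1 j)

theorem tsum_mul_tsum_eq_tsum_tsum_sub {β : Type*} {u : β → ℂ} {v : ℤ → ℂ}
    (hu : Summable fun b => ‖u b‖) (hv : Summable fun m => ‖v m‖) (d : β → ℤ) :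
    (∑' b, u b) * ∑' m, v m = ∑' s : ℤ, ∑' b, u b * v (s - d b) := by
  let e : β × ℤ ≃ β × ℤ := (Equiv.refl β).prodShear fun b => Equiv.subRight (d b)
  have hs : Summable fun x : β × ℤ => u x.1 * v (x.2 - d x.1) :=
    (e.summable_iff (f := fun x : β × ℤ => u x.1 * v x.2)).2 (summable_mul_of_summable_norm hu hv)
  rw [tsum_mul_tsum_of_summable_norm hu hv, ← e.tsum_eq]
  exact hs.tsum_prod.trans (Summable.tsum_comm (f := fun s b => u b * v (s - d b))
    ((Equiv.prodComm ℤ β).summable_iff.2 hs))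

theorem seriesB_mul_thetaSeries {a : ℕ} (ha : a ≠ 0) (j : Fin a) {q z : ℂ} (hq0 : q ≠ 0)
    (hq : ‖q‖ < 1) (hz : z ≠ 0) :
    seriesB j z q * thetaSeries (q ^ a) z = ∑' s : ℤ, mulCoeff j q s * z ^ s := by
  have h1 := summable_norm_termB j hq0 hq hz
  have h2 := summable_norm_thetaCoeff_mul (pow_ne_zero a hq0) (norm_pow_lt_one hq ha) hz
  rw [seriesB, thetaSeries, tsum_mul_tsum_eq_tsum_tsum_sub h1 h2 fun n => n.1 j]
  refine tsum_congr fun s => ?_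
  rw [mulCoeff, ← tsum_mul_right]
  refine tsum_congr fun n => ?_
  rw [termB_eq j z hq0, zpow_sub₀ hz]
  have := zpow_ne_zero (n.1 j) hz
  field_simp

/-- Reindex by `a e_j - (1,…,1)`, which has sum zero. The factor depending on `n_j` cancels against
the step of the `q^a`-theta coefficient. -/
theorem mulCoeff_add {a : ℕ} (ha : a ≠ 0) (j : Fin a) {q : ℂ} (hq0 : q ≠ 0) (s : ℤ) :
    mulCoeff j q (s + a) = thetaCoeff q a * q ^ (a * s) * mulCoeff j q s := by
  have hp : q ^ a ≠ 0 := pow_ne_zero _ hq0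
  let e : ZeroSumVec a ≃ ZeroSumVec a :=
    (Equiv.addRight (Pi.single j (a : ℤ) - 1 : Fin a → ℤ)).subtypeEquiv fun n => by
      simp [add_dotProduct, sub_dotProduct]
  rw [mulCoeff, ← e.tsum_eq, mulCoeff, ← tsum_mul_left]
  refine tsum_congr fun n => ?_
  have hev : (e n).1 = n.1 + (Pi.single j (a : ℤ) - 1) := rfl
  have h1 := latticeCoeff_add_one ha hq0 (e n).1
  have h2 := latticeCoeff_add_single j hq0 n.1 a
  have hω : (rootω a ^ (j : ℕ)) ^ (a : ℤ) = 1 := by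
    rw [zpow_natCast, ← pow_mul, mul_comm, pow_mul, (isPrimitiveRoot_rootω ha).pow_eq_one, one_pow]
  rw [(e n).2, zpow_zero, show (e n).1 + 1 = n.1 + Pi.single j (a : ℤ) by rw [hev]; abel, h2,
    hω] at h1
  have h3 : latticeCoeff q (e n).1 =
      -(thetaCoeff q a * q ^ (a * n.1 j) * latticeCoeff q n.1) := by
    linear_combination h1
  -- The `j`-th coordinate grows by `a - 1`, so the theta index moves by one.
  have h4 : s + a - (e n).1 j = s - n.1 j + 1 := by
    rw [hev]; simp; ring
  rw [h3, h4, thetaCoeff_add_one hp, ← zpow_natCast, ← _root_.zpow_mul, mul_sub, zpow_sub₀ hq0]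
  have := zpow_ne_zero (a * n.1 j) hq0
  field_simp

theorem seriesB_mul_thetaSeries_zpow {a : ℕ} (ha : a ≠ 0) (j : Fin a) {q : ℂ} (hq0 : q ≠ 0)
    (k : ℤ) : seriesB j (q ^ k) q * thetaSeries (q ^ a) (q ^ k) = 0 := by
  by_cases hk : (a : ℤ) ∣ k
  · obtain ⟨l, rfl⟩ := hk
    rw [_root_.zpow_mul, zpow_natCast, thetaSeries_zpow (pow_ne_zero a hq0), mul_zero]
  · rw [seriesB_zpow_eq_zero ha j hq0 hk, zero_mul]

theorem exists_seriesB_mul_thetaSeries_eq {a : ℕ} (ha : a ≠ 0) (j : Fin a) {q : ℂ} (hq0 : q ≠ 0)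
    (hq : ‖q‖ < 1) : ∃ c : ℂ, ∀ z : ℂ, z ≠ 0 →
      seriesB j z q * thetaSeries (q ^ a) z = c * thetaSeries q z := by
  have : NeZero a := ⟨ha⟩
  let ratio (s : ℤ) : ℂ := mulCoeff j q s / thetaCoeff q s
  have hratio (s : ℤ) : ratio s * thetaCoeff q s = mulCoeff j q s :=
    div_mul_cancel₀ _ (thetaCoeff_ne_zero hq0 s)
  have hper : Function.Periodic ratio a := fun s => by
    simp only [ratio]
    rw [mulCoeff_add ha j hq0, thetaCoeff_add hq0]
    have h1 := thetaCoeff_ne_zero hq0 s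
    have h2 := thetaCoeff_ne_zero hq0 a
    have h3 := zpow_ne_zero (a * s) hq0
    field_simp
  let lam (r : ZMod a) : ℂ := ratio r.val
  have hlam (s : ℤ) : lam s = ratio s := by
    simp only [lam]
    rw [ZMod.val_intCast, Int.emod_def, mul_comm]
    exact hper.sub_int_mul_eq _
  -- The zero at `z = q^k`, after shifting the index by `k`, is the annihilation condition on `lam`.
  have hzero (k : ℤ) : ∑' s : ℤ, lam (s - k) * thetaCoeff q s = 0 := by
    rw [← (Equiv.addRight k).tsum_eq]
    have h := seriesB_mul_thetaSeries_zpow ha j hq0 k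
    rw [seriesB_mul_thetaSeries ha j hq0 hq (zpow_ne_zero k hq0)] at h
    rw [← mul_zero (thetaCoeff q k), ← h, ← tsum_mul_left]
    refine tsum_congr fun s => ?_
    simp only [Equiv.coe_addRight, Int.cast_add, add_sub_cancel_right]
    rw [hlam, thetaCoeff_add hq0, ← hratio, ← _root_.zpow_mul]
    ring
  have hconst (s : ℤ) : mulCoeff j q s = lam 0 * thetaCoeff q s := by
    rw [← hratio, ← hlam, eq_const_of_tsum_mul_thetaCoeff_eq_zero hq0 hq hzero]
  refine ⟨lam 0, fun z hz => ?_⟩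
  rw [seriesB_mul_thetaSeries ha j hq0 hq hz, thetaSeries, ← tsum_mul_left]
  exact tsum_congr fun s => by rw [hconst, mul_assoc]

/-! ### Determination of the constant at `z = 1`. -/

/-- The theta product without its factor `1 - z`. -/
noncomputable def reducedThetaProd (q z : ℂ) : ℂ :=
  (∏' n : ℕ, (1 - z * q ^ (n + 1))) * ∏' n : ℕ, (1 - z⁻¹ * q ^ (n + 1))

theorem thetaProd_eq_one_sub_mul {q : ℂ} (hq : ‖q‖ < 1) (z : ℂ) :
    thetaProd q z = (1 - z) * reducedThetaProd q z := by
  have h := tprod_eq_zero_mul' (f := fun n : ℕ => 1 - z * q ^ n)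
    (multipliable_one_sub_mul_pow_succ hq z)
  rw [thetaProd_eq_mul hq, h, reducedThetaProd, pow_zero, mul_one, mul_assoc]

theorem tendsto_reducedThetaProd {q : ℂ} (hq : ‖q‖ < 1) :
    Tendsto (reducedThetaProd q) (𝓝 1) (𝓝 (eulerE q ^ 2)) := by
  have h : Tendsto (fun c : ℂ => ∏' n : ℕ, (1 - c * q ^ (n + 1))) (𝓝 1) (𝓝 (eulerE q)) := by
    simp only [sub_eq_add_neg, eulerE]
    refine tendsto_tprod_one_add_of_dominated_convergence
      (summable_norm_mul_pow_succ hq 2) (fun n => ?_) ?_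
    · have : Continuous fun c : ℂ => -(c * q ^ (n + 1)) := by fun_prop
      simpa using this.tendsto 1
    · have : ∀ᶠ c : ℂ in 𝓝 1, ‖c‖ < 2 :=
        continuous_norm.tendsto (1 : ℂ) |>.eventually_lt_const (by simp)
      filter_upwards [this] with c hc n
      simp only [norm_neg, norm_mul, Complex.norm_ofNat]
      gcongr
  have hinv : Tendsto (fun z : ℂ => z⁻¹) (𝓝 1) (𝓝 1) := by
    simpa using (continuousAt_inv₀ (one_ne_zero (α := ℂ))).tendsto
  rw [pow_two]
  exact h.mul (h.comp hinv)

/-- The inner radius dominates for negative `m`, the outer for nonnegative `m`; the sum covers both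
and is still summable against the coefficients. -/
theorem norm_zpow_le_add {w : ℂ} {r R : ℝ} (hr : 0 < r) (h1 : r ≤ ‖w‖) (h2 : ‖w‖ ≤ R) (m : ℤ) :
    ‖w ^ m‖ ≤ r ^ m + R ^ m := by
  have hR : 0 < R := hr.trans_le (h1.trans h2)
  rw [norm_zpow]
  rcases le_total 0 m with hm | hm
  · exact (zpow_le_zpow_left₀ hm (norm_nonneg w) h2).trans
      (le_add_of_nonneg_left (zpow_pos hr m).le)
  · obtain ⟨k, rfl⟩ := Int.exists_eq_neg_ofNat hm
    refine le_trans ?_ (le_add_of_nonneg_right (zpow_pos hR _).le)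
    simp only [_root_.zpow_neg, zpow_natCast]
    gcongr

theorem tendsto_seriesB {a : ℕ} (j : Fin a) {q z : ℂ} (hq0 : q ≠ 0) (hq : ‖q‖ < 1) (hz : z ≠ 0) :
    Tendsto (fun w => seriesB j w q) (𝓝 z) (𝓝 (seriesB j z q)) := by
  have hz' : 0 < ‖z‖ := norm_pos_iff.2 hz
  have hr : (((‖z‖ / 2 : ℝ)) : ℂ) ≠ 0 := by exact_mod_cast (half_pos hz').ne'
  have hR : (((2 * ‖z‖ : ℝ)) : ℂ) ≠ 0 := by exact_mod_cast (mul_pos two_pos hz').ne'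
  refine tendsto_tsum_of_dominated_convergence
    ((summable_norm_termB j hq0 hq hr).add (summable_norm_termB j hq0 hq hR)) (fun n => ?_) ?_
  · exact ((continuousAt_zpow₀ z _ (Or.inl hz)).tendsto.mul_const _).mul_const _
  · have h1 : ∀ᶠ w : ℂ in 𝓝 z, ‖z‖ / 2 < ‖w‖ :=
      (continuous_norm.tendsto z).eventually_const_lt (half_lt_self hz')
    have h2 : ∀ᶠ w : ℂ in 𝓝 z, ‖w‖ < 2 * ‖z‖ :=
      (continuous_norm.tendsto z).eventually_lt_const (by linarith)
    filter_upwards [h1, h2] with w hw1 hw2 n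
    have h := norm_zpow_le_add (half_pos hz') hw1.le hw2.le (n.1 j)
    simp only [termB_eq j _ hq0, norm_mul, ← add_mul]
    refine mul_le_mul_of_nonneg_right (h.trans_eq ?_) (norm_nonneg _)
    rw [norm_zpow, norm_zpow, Complex.norm_of_nonneg (half_pos hz').le,
      Complex.norm_of_nonneg (by positivity)]

theorem seriesB_mul_thetaProd {a : ℕ} (ha : 2 ≤ a) (j : Fin a) {q z : ℂ} (hq0 : q ≠ 0)
    (hq : ‖q‖ < 1) (hz : z ≠ 0) :
    seriesB j z q * thetaProd (q ^ a) z =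
      eulerE q ^ (a - 2) * eulerE (q ^ a) * thetaProd q z := by
  have ha0 : a ≠ 0 := by omega
  have hp := norm_pow_lt_one hq ha0
  have hE := eulerE_ne_zero hq
  have hEp := eulerE_ne_zero hp
  obtain ⟨c, hc⟩ := exists_seriesB_mul_thetaSeries_eq ha0 j hq0 hq
  have hT (w : ℂ) (hw : w ≠ 0) : seriesB j w q * (eulerE (q ^ a) * thetaProd (q ^ a) w) =
      c * (eulerE q * thetaProd q w) := by
    rw [← thetaSeries_eq (pow_ne_zero a hq0) hp hw, hc w hw, thetaSeries_eq hq0 hq hw]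
  -- Both theta products vanish at `1`, so the common factor `1 - w` is removed before letting `w →
  -- 1`.
  have hlim1 : Tendsto (fun w => seriesB j w q * (eulerE (q ^ a) * reducedThetaProd (q ^ a) w))
      (𝓝[≠] 1) (𝓝 (seriesB j 1 q * (eulerE (q ^ a) * eulerE (q ^ a) ^ 2))) :=
    ((tendsto_seriesB j hq0 hq one_ne_zero).mul
      ((tendsto_reducedThetaProd hp).const_mul _)).mono_left nhdsWithin_le_nhds
  have hlim2 : Tendsto (fun w => seriesB j w q * (eulerE (q ^ a) * reducedThetaProd (q ^ a) w))
      (𝓝[≠] 1) (𝓝 (c * (eulerE q * eulerE q ^ 2))) := by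
    refine ((((tendsto_reducedThetaProd hq).const_mul _).const_mul c).mono_left
      nhdsWithin_le_nhds).congr' ?_
    have h0 : ∀ᶠ w : ℂ in 𝓝[≠] 1, w ≠ 0 :=
      (isOpen_ne.mem_nhds one_ne_zero : {w : ℂ | w ≠ 0} ∈ 𝓝 1) |> mem_nhdsWithin_of_mem_nhds
    filter_upwards [self_mem_nhdsWithin, h0] with w hw1 hw0
    have h := hT w hw0
    rw [thetaProd_eq_one_sub_mul hq, thetaProd_eq_one_sub_mul hp] at h
    refine mul_left_cancel₀ (sub_ne_zero.2 (Ne.symm hw1)) ?_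
    linear_combination -h
  have hconst := tendsto_nhds_unique hlim1 hlim2
  have h1 := seriesB_one_mul_eulerE ha0 j hq0 hq
  have hpow : eulerE q ^ a = eulerE q ^ (a - 2) * eulerE q ^ 2 := by
    rw [← pow_add]; congr 1; omega
  -- This factor clears `c` and the denominator of `B(1)` at once.
  refine mul_left_cancel₀ (mul_ne_zero hEp (pow_ne_zero 2 hE)) ?_
  linear_combination eulerE q ^ 2 * hT z hz - thetaProd q z * hconst +
    thetaProd q z * eulerE (q ^ a) ^ 2 * (h1.trans hpow)

/-! ### The quotient form, the case `q = 0`, and removable singularities. -/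

theorem quotFactor_eq (a : ℕ) (z q : ℂ) (n : ℕ) :
    quotFactor a z q n = ((1 - z * q ^ n) * (1 - z⁻¹ * q ^ (n + 1))) /
      ((1 - z * (q ^ a) ^ n) * (1 - z⁻¹ * (q ^ a) ^ (n + 1))) := by
  rw [quotFactor, pow_mul, pow_mul]

theorem hasProd_quotFactor {a : ℕ} (ha : a ≠ 0) {z q : ℂ} (hq : ‖q‖ < 1)
    (h : ∀ n : ℕ, 1 - z * q ^ (a * n) ≠ 0 ∧ 1 - z⁻¹ * q ^ (a * (n + 1)) ≠ 0) :
    HasProd (quotFactor a z q) (thetaProd q z / thetaProd (q ^ a) z) ∧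
      thetaProd (q ^ a) z ≠ 0 := by
  have hp := norm_pow_lt_one hq ha
  have hne : thetaProd (q ^ a) z ≠ 0 := thetaProd_ne_zero hp (by simpa only [← pow_mul] using h)
  refine ⟨?_, hne⟩
  rw [funext (quotFactor_eq a z q)]
  exact (multipliable_thetaProd hq z).hasProd.div₀ (multipliable_thetaProd hp z).hasProd hne

theorem termB_zero {a : ℕ} (j : Fin a) (z : ℂ) (n : ZeroSumVec a) :
    termB j z 0 n = if n = ⟨0, by simp⟩ then 1 else 0 := by
  split_ifs with h
  · subst h; simp [termB]
  · have h1 : (n.1 ⬝ᵥ n.1) / 2 ≠ 0 := by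
      intro h0
      have h2 := n.two_mul_half
      rw [h0, mul_zero] at h2
      exact h (Subtype.ext (dotProduct_self_eq_zero.1 h2.symm))
    rw [termB, _root_.zero_zpow _ h1, mul_zero]

theorem seriesB_zero {a : ℕ} (j : Fin a) (z : ℂ) : seriesB j z 0 = 1 := by
  simp only [seriesB, termB_zero, tsum_ite_eq]

theorem summable_termB {a : ℕ} (j : Fin a) {z q : ℂ} (hz : z ≠ 0) (hq : ‖q‖ < 1) :
    Summable (termB j z q) := by
  by_cases hq0 : q = 0
  · subst hq0
    rw [funext (termB_zero j z)]
    exact (hasSum_ite_eq _ _).summable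
  · exact (summable_norm_termB j hq0 hq hz).of_norm

theorem seriesB_eq_productSide {a : ℕ} (ha : 2 ≤ a) (j : Fin a) {z q : ℂ} (hz : z ≠ 0)
    (hq : ‖q‖ < 1)
    (h : ∀ n : ℕ, 1 - z * q ^ (a * n) ≠ 0 ∧ 1 - z⁻¹ * q ^ (a * (n + 1)) ≠ 0) :
    seriesB j z q = productSide a z q := by
  have ha0 : a ≠ 0 := by omega
  obtain ⟨hprod, hne⟩ := hasProd_quotFactor ha0 hq h
  rw [productSide, hprod.tprod_eq, ← mul_div_assoc, eq_div_iff hne]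
  -- At `q = 0` the theta coefficients may vanish, but the series reduces to its term at the zero
  -- vector.
  by_cases hq0 : q = 0
  · subst hq0
    rw [seriesB_zero, zero_pow ha0]
    simp [eulerE]
  · exact seriesB_mul_thetaProd ha j hq0 hq hz

/-- The zeros of the denominators accumulate only at `0` and infinity. On an annulus around `z` norm
bounds exclude all large `n`, leaving finitely many points to avoid. -/
theorem eventually_denominator_ne_zero {a : ℕ} (ha : a ≠ 0) {z q : ℂ} (hz : z ≠ 0)
    (hq : ‖q‖ < 1) : ∀ᶠ w in 𝓝[≠] z,
      w ≠ 0 ∧ ∀ n : ℕ, 1 - w * q ^ (a * n) ≠ 0 ∧ 1 - w⁻¹ * q ^ (a * (n + 1)) ≠ 0 := by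
  have hp := norm_pow_lt_one hq ha
  have hz' : 0 < ‖z‖ := norm_pos_iff.2 hz
  have hne (c : ℂ) : ∀ᶠ w in 𝓝[≠] z, w ≠ c :=
    nhdsNE_le_cofinite z (Set.finite_singleton c).compl_mem_cofinite
  have hfar : ∀ᶠ w : ℂ in 𝓝[≠] z, ‖z‖ / 2 < ‖w‖ ∧ ‖w‖ < 2 * ‖z‖ :=
    (((continuous_norm.tendsto z).eventually_const_lt (half_lt_self hz')).and
      ((continuous_norm.tendsto z).eventually_lt_const (by linarith))).filter_mono
        nhdsWithin_le_nhds
  have hpow : Tendsto (fun n : ℕ => ‖q ^ a‖ ^ n) atTop (𝓝 0) :=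
    tendsto_pow_atTop_nhds_zero_of_lt_one (norm_nonneg _) hp
  have hsmall : ∀ᶠ n : ℕ in atTop, 2 * ‖z‖ * ‖q ^ a‖ ^ n < 1 ∧ ‖q ^ a‖ ^ n < ‖z‖ / 2 :=
    ((hpow.const_mul (2 * ‖z‖)).eventually_lt_const (by simp)).and
      (hpow.eventually_lt_const (half_pos hz'))
  obtain ⟨N, hN⟩ := eventually_atTop.1 hsmall
  have hnear : ∀ᶠ w in 𝓝[≠] z, ∀ n ∈ Finset.range N,
      w ≠ ((q ^ a) ^ n)⁻¹ ∧ w ≠ (q ^ a) ^ (n + 1) :=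
    (Finset.eventually_all _).2 fun n _ => (hne _).and (hne _)
  filter_upwards [hne 0, hfar, hnear] with w hw0 hw hwn
  refine ⟨hw0, fun n => ?_⟩
  rw [pow_mul, pow_mul]
  rcases lt_or_ge n N with hn | hn
  · obtain ⟨h1, h2⟩ := hwn n (Finset.mem_range.2 hn)
    refine ⟨fun h => h1 ?_, fun h => h2 ?_⟩
    · exact eq_inv_of_mul_eq_one_left (sub_eq_zero.1 h).symm
    · exact (eq_of_inv_mul_eq_one (sub_eq_zero.1 h).symm)
  · have hwpos : 0 < ‖w‖ := norm_pos_iff.2 hw0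
    refine ⟨one_sub_ne_zero_of_norm_lt_one ?_, one_sub_ne_zero_of_norm_lt_one ?_⟩
    · rw [norm_mul, norm_pow]
      refine lt_of_le_of_lt ?_ (hN n hn).1
      gcongr
      exact hw.2.le
    · rw [norm_mul, norm_inv, norm_pow, inv_mul_lt_one₀ hwpos]
      exact (hN (n + 1) (by omega)).2.trans hw.1

/-- At an exceptional `z` the quotient contains a division by zero, so the value there is stated as
a punctured limit; it follows from continuity of the series in `z`. -/
theorem theorem2 (a : ℕ) (ha : 2 ≤ a) (j : Fin a) (z q : ℂ) (hz : z ≠ 0) (hq : ‖q‖ < 1) :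
    Summable (termB j z q) ∧
    ((∀ n : ℕ, 1 - z * q ^ (a * n) ≠ 0 ∧ 1 - z⁻¹ * q ^ (a * (n + 1)) ≠ 0) →
      Multipliable (quotFactor a z q) ∧ seriesB j z q = productSide a z q) ∧
    Tendsto (fun w : ℂ => productSide a w q) (𝓝[≠] z) (𝓝 (seriesB j z q)) := by
  have ha0 : a ≠ 0 := by omega
  refine ⟨summable_termB j hz hq, fun h => ⟨(hasProd_quotFactor ha0 hq h).1.multipliable,
    seriesB_eq_productSide ha j hz hq h⟩, ?_⟩
  have hlim : Tendsto (fun w => seriesB j w q) (𝓝 z) (𝓝 (seriesB j z q)) := by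
    by_cases hq0 : q = 0
    · subst hq0
      simp only [seriesB_zero]
      exact tendsto_const_nhds
    · exact tendsto_seriesB j hq0 hq hz
  refine (hlim.mono_left nhdsWithin_le_nhds).congr' ?_
  filter_upwards [eventually_denominator_ne_zero ha0 hz hq] with w hw
  exact seriesB_eq_productSide ha j hw.1 hq hw.2
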